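/- Let $\alpha\in[0,\tfrac12]$ be the attacker's share of the computational power, $\gamma\in[0,1]$, $T_0\ge 1$ an integer and $\epsilon>0$. **Decision problem.** States are triples $(a,h,\mathit{fork})$ with $a,h\in\mathbb N$ and $\mathit{fork}\in\{\text{irrelevant},\text{relevant},\text{active}\}$. The initial state $X_0$ is $(1,0,\text{irrelevant})$ with probability $\alpha$ and $(0,1,\text{irrelevant})$ with probability $1-\alpha$. The actions, their transitions and rewards $(r^1,r^2)$ (accepted blocks of the attacker and of the honest nodes) are: - *adopt* (always feasible): the next state is distributed as $X_0$; reward $(0,h)$. - *override* (feasible if $a>h$): to $(a-h,0,\text{irrelevant})$ with probability $\alpha$, to $(a-h-1,1,\text{relevant})$ with probability $1-\alpha$; reward $(h+1,0)$. - *wait* (always feasible) with fork irrelevant or relevant: to $(a+1,h,\text{irrelevant})$ with probability $\alpha$, to $(a,h+1,\text{relevant})$ with probability $1-\alpha$; reward $(0,0)$. - *wait* with fork active, and *match* (feasible if fork is relevant and $a\ge h$): to $(a+1,h,\text{active})$ with probability $\alpha$, reward $(0,0)$; to $(a-h,1,\text{relevant})$ with probability $\gamma(1-\alpha)$, reward $(h,0)$;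 to $(a,h+1,\text{relevant})$ with probability $(1-\gamma)(1-\alpha)$, reward $(0,0)$. A policy $\pi$ assigns to each state a feasible action; $A^{T_0}$ is the set of policies that choose *adopt* in every state with $\max\{a,h\}=T_0$. Let $r_t=(r^1_t,r^2_t)$ be the reward of the transition from $X_t$ to $X_{t+1}$ under $\pi$, and $$\mathrm{REV}(\pi)=\mathbb E\Big[\liminf_{T\to\infty}\frac{\sum_{t=1}^T r^1_t}{\sum_{t=1}^T (r^1_t+r^2_t)}\Big],\qquad v^\pi_\rho=\mathbb E\Big[\liminf_{T\to\infty}\frac1T\sum_{t=1}^T\big((1-\rho)r^1_t-\rho\, r^2_t\big)\Big].$$ An MDP solver is a procedure that for all $\rho\in[0,1]$ and $\delta>0$ returns a pair $(\pi,v)$ such that $\pi\in A^{T_0}$, $v^{\pi'}_\rho\le v^\pi_\rho+\delta$ for all $\pi'\in A^{T_0}$, and $v=v^\pi_\rho$. **Algorithm.** Put $low=0$, $high=1$. Repeat: set $\rho=(low+high)/2$, call the solver with $(\rho,\epsilon/8)$ to obtain $(\pi,v)$, and set $low=\rho$ if $v>0$ and $high=\rho$ otherwise; until $high-low<\epsilon/8$.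 The output is the last $(\rho,\pi)$. **Claim.** Such a solver exists, and for every such solver the algorithm halts. Its output satisfies $\pi\in A^{T_0}$; the maximum $\max_{\pi'\in A^{T_0}}\mathrm{REV}(\pi')$ exists; and $$|\rho-\mathrm{REV}(\pi)|<\epsilon,\qquad \Big|\rho-\max_{\pi'\in A^{T_0}}\mathrm{REV}(\pi')\Big|<\epsilon,\qquad \mathrm{REV}(\pi)>\max_{\pi'\in A^{T_0}}\mathrm{REV}(\pi')-\epsilon .$$ -/

import Mathlib

namespace SelfishMining

open MeasureTheory Filter

/-- The label `fork` of a state. -/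
inductive Fork
  | irrelevant
  | relevant
  | active
  deriving DecidableEq

/-- A state `(a, h, fork)`: the lengths of the attacker's branch and of the honest branch after
the latest fork, and the fork label. -/
@[ext] structure State where
  a : ℕ
  h : ℕ
  fork : Fork

/-- The attacker's actions; `matchBlock` is the action "match". -/
inductive Action
  | adopt
  | override
  | matchBlock
  | wait
  deriving DecidableEq

/-- The creator of a new block: the attacker (probability `α`), an honest node among the fraction
`γ` that receives the attacker's competing block first (probability `γ (1 - α)`), or one of the
other honest nodes (probability `(1 - γ) (1 - α)`). -/
inductive Block
  | attacker
  | honestReached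
  | honestOther
  deriving DecidableEq

instance : MeasurableSpace Block := ⊤

instance : DiscreteMeasurableSpace Block := ⟨fun _ => trivial⟩

/-- The law of the creator of one block. -/
noncomputable def blockLaw (α γ : Set.Icc (0 : ℝ) 1) : Measure Block :=
  ENNReal.ofReal α • Measure.dirac Block.attacker
    + ENNReal.ofReal (γ * (1 - α)) • Measure.dirac Block.honestReached
    + ENNReal.ofReal ((1 - γ) * (1 - α)) • Measure.dirac Block.honestOther

instance (α γ : Set.Icc (0 : ℝ) 1) : IsProbabilityMeasure (blockLaw α γ) := by
  obtain ⟨α, hα0, hα1⟩ := α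
  obtain ⟨γ, hγ0, hγ1⟩ := γ
  have h1 : 0 ≤ γ * (1 - α) := mul_nonneg hγ0 (by linarith)
  have h2 : 0 ≤ (1 - γ) * (1 - α) := mul_nonneg (by linarith) (by linarith)
  constructor
  simp only [blockLaw, Measure.add_apply, Measure.smul_apply, measure_univ, smul_eq_mul, mul_one]
  rw [← ENNReal.ofReal_add hα0 h1, ← ENNReal.ofReal_add (by linarith) h2, ← ENNReal.ofReal_one]
  congr 1
  ring

/-- The law of the whole sequence of block creations: independent, each with law `blockLaw`. -/
noncomputable def blocksLaw (α γ : Set.Icc (0 : ℝ) 1) : Measure (ℕ → Block) :=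
  Measure.infinitePi fun _ => blockLaw α γ

/-- The state at the beginning and after an adoption: `(1, 0, irrelevant)` with probability `α`,
`(0, 1, irrelevant)` with probability `1 - α`. -/
def start : Block → State
  | .attacker => ⟨1, 0, .irrelevant⟩
  | _ => ⟨0, 1, .irrelevant⟩

/-- The transition when the honest network is not split and the attacker publishes nothing. -/
def extend (s : State) : Block → State
  | .attacker => ⟨s.a + 1, s.h, .irrelevant⟩
  | _ => ⟨s.a, s.h + 1, .relevant⟩

/-- The transition when the honest network is split between two branches of length `h`. -/
def race (s : State) : Block → State
  | .attacker => ⟨s.a + 1, s.h, .active⟩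
  | .honestReached => ⟨s.a - s.h, 1, .relevant⟩
  | .honestOther => ⟨s.a, s.h + 1, .relevant⟩

/-- The next state, given the present state, the action, and the creator of the next block
(for feasible actions all subtractions are exact). -/
def next (s : State) : Action → Block → State
  | .adopt, b => start b
  | .override, .attacker => ⟨s.a - s.h, 0, .irrelevant⟩
  | .override, _ => ⟨s.a - s.h - 1, 1, .relevant⟩
  | .matchBlock, b => race s b
  | .wait, b =>
    match s.fork with
    | .active => race s b
    | _ => extend s b

/-- The reward of a transition during a race: the attacker gets `h` if the next block is built by
an honest node on top of the attacker's published blocks. -/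
def raceReward (s : State) : Block → ℕ × ℕ
  | .honestReached => (s.h, 0)
  | _ => (0, 0)

/-- The reward `(r¹, r²)`: numbers of accepted blocks of the attacker and of the honest nodes. -/
def reward (s : State) : Action → Block → ℕ × ℕ
  | .adopt, _ => (0, s.h)
  | .override, _ => (s.h + 1, 0)
  | .matchBlock, b => raceReward s b
  | .wait, b =>
    match s.fork with
    | .active => raceReward s b
    | _ => (0, 0)

/-- Feasibility of an action in the untruncated problem. -/
def Feasible (s : State) : Action → Prop
  | .adopt => True
  | .override => s.h < s.a
  | .matchBlock => s.fork = .relevant ∧ s.h ≤ s.a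
  | .wait => True

/-- A (stationary, deterministic) policy. -/
abbrev Policy := State → Action

/-- The truncated policies `A^T`: every action is feasible, and in the states with
`max {a, h} = T` only `adopt` is allowed. -/
def truncatedPolicies (T : ℕ) : Set Policy :=
  {π | ∀ s : State, Feasible s (π s) ∧ (max s.a s.h = T → π s = .adopt)}

/-- The state `X_t` under `π`, as a function of the block creations; block `0` determines `X_0`,
and block `t + 1` the transition from `X_t` to `X_{t+1}`. -/
def stateAt (π : Policy) (ω : ℕ → Block) : ℕ → State
  | 0 => start (ω 0)
  | t + 1 => next (stateAt π ω t) (π (stateAt π ω t)) (ω (t + 1))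

/-- The reward `r_t` of the transition from `X_t` to `X_{t+1}`. -/
def rewardAt (π : Policy) (ω : ℕ → Block) (t : ℕ) : ℕ × ℕ :=
  reward (stateAt π ω t) (π (stateAt π ω t)) (ω (t + 1))

/-- The relative revenue
`REV(π) = E [liminf_T (∑_{t ≤ T} r¹_t) / (∑_{t ≤ T} (r¹_t + r²_t))]`. -/
noncomputable def REV (α γ : Set.Icc (0 : ℝ) 1) (π : Policy) : ℝ :=
  ∫ ω, liminf (fun T : ℕ =>
    (∑ t ∈ Finset.Icc 1 T, ((rewardAt π ω t).1 : ℝ)) /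
      ∑ t ∈ Finset.Icc 1 T, (((rewardAt π ω t).1 : ℝ) + (rewardAt π ω t).2)) atTop
    ∂(blocksLaw α γ)

/-- The linearized reward `w_ρ(x, y) = (1 - ρ) x - ρ y`. -/
def w (ρ : ℝ) (r : ℕ × ℕ) : ℝ := (1 - ρ) * r.1 - ρ * r.2

/-- The expected mean revenue `v^π_ρ = E [liminf_T (1/T) ∑_{t ≤ T} w_ρ(r_t)]`. -/
noncomputable def value (α γ : Set.Icc (0 : ℝ) 1) (ρ : ℝ) (π : Policy) : ℝ :=
  ∫ ω, liminf (fun T : ℕ => (1 / (T : ℝ)) * ∑ t ∈ Finset.Icc 1 T, w ρ (rewardAt π ω t)) atTop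
    ∂(blocksLaw α γ)

/-- `π` is `δ`-optimal in the truncated decision problem `M^T_ρ`. -/
def IsApproxOptimal (α γ : Set.Icc (0 : ℝ) 1) (T : ℕ) (ρ δ : ℝ) (π : Policy) : Prop :=
  π ∈ truncatedPolicies T ∧
    ∀ π' ∈ truncatedPolicies T, value α γ ρ π' ≤ value α γ ρ π + δ

/-- `solver` solves all the problems `M^T_ρ` to any accuracy: on the input `(ρ, δ)` it returns a
`δ`-optimal policy of `M^T_ρ` together with the value of this policy. -/
def IsMDPSolver (α γ : Set.Icc (0 : ℝ) 1) (T : ℕ) (solver : ℝ → ℝ → Policy × ℝ) : Prop :=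
  ∀ ρ ∈ Set.Icc (0 : ℝ) 1, ∀ δ : ℝ, 0 < δ →
    IsApproxOptimal α γ T ρ δ (solver ρ δ).1 ∧ (solver ρ δ).2 = value α γ ρ (solver ρ δ).1

/-- The variables `low` and `high` of the binary search. -/
structure Segment where
  low : ℝ
  high : ℝ

/-- The assignment `ρ ← (low + high) / 2`. -/
noncomputable def Segment.mid (s : Segment) : ℝ := (s.low + s.high) / 2

open Classical in
/-- One pass through the body of the loop: with `ρ = (low + high) / 2` and
`(π, v) = solver ρ (ε / 8)`, assign `ρ` to `low` if `v > 0`, and to `high` otherwise. -/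
noncomputable def loopBody (solver : ℝ → ℝ → Policy × ℝ) (ε : ℝ) (s : Segment) : Segment :=
  if 0 < (solver s.mid (ε / 8)).2 then ⟨s.mid, s.high⟩ else ⟨s.low, s.mid⟩

/-- The binary search, a do-while loop started at `low = 0`, `high = 1` and repeated as long as
`high - low ≥ ε / 8`, halts, and `ρ` and `π` are the values assigned in the last pass (the pass
number `n`, counting from `0`). -/
def HaltsWithOutput (solver : ℝ → ℝ → Policy × ℝ) (ε ρ : ℝ) (π : Policy) : Prop :=
  ∃ n : ℕ,
    (∀ k < n, ε / 8 ≤ ((loopBody solver ε)^[k + 1] ⟨0, 1⟩).high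
      - ((loopBody solver ε)^[k + 1] ⟨0, 1⟩).low) ∧
    ((loopBody solver ε)^[n + 1] ⟨0, 1⟩).high - ((loopBody solver ε)^[n + 1] ⟨0, 1⟩).low < ε / 8 ∧
    ρ = ((loopBody solver ε)^[n] ⟨0, 1⟩).mid ∧
    π = (solver ρ (ε / 8)).1

end SelfishMining

namespace SelfishMining

open MeasureTheory Filter

/-! The point is the identity `value ρ π = g * (REV π - ρ)`, where `g`, the long-run number of
accepted blocks per step, depends on `π` but not on `ρ` and lies in `[1/2, 1]`. The sign of the
value thus tells on which side of `ρ` the relative revenue lies, and errors in value and in revenue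
agree up to a factor 2.

Each honest block lengthens the public chain by at least one, so `g ≥ 1 - α ≥ 1/2`; at most one
block is created per step, so `g ≤ 1`. The identity needs the average rewards to converge almost
surely to constants (`exists_ae_tendsto_average`). Under a truncated policy the chain lives on a
finite set, and runs of honest blocks force an adoption, leading to `(0, 1, irrelevant)`. A maximum
principle then solves the Poisson equation, which reduces the average to that of a martingale with
bounded increments.

In the binary search `low ≤ m` holds exactly for the maximal revenue `m`, since a positive value
exhibits a policy. A nonpositive value of an `ε/8`-optimal policy only gives `m ≤ ρ + ε/4`. The
maximum exists because only the finitely many restrictions of policies to reachable states matter.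
-/

instance : Finite Fork :=
  Finite.of_surjective (fun i : Fin 3 => if i = 0 then Fork.irrelevant else
    if i = 1 then Fork.relevant else Fork.active) fun f => by
      cases f
      · exact ⟨0, rfl⟩
      · exact ⟨1, rfl⟩
      · exact ⟨2, rfl⟩

instance : Finite Action :=
  Finite.of_surjective (fun i : Fin 4 => if i = 0 then Action.adopt else
    if i = 1 then Action.override else if i = 2 then Action.matchBlock else Action.wait)
    fun f => by
      cases f
      · exact ⟨0, rfl⟩
      · exact ⟨1, rfl⟩
      · exact ⟨2, rfl⟩
      · exact ⟨3, rfl⟩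

instance : Finite Block :=
  Finite.of_surjective (fun i : Fin 3 => if i = 0 then Block.attacker else
    if i = 1 then Block.honestReached else Block.honestOther) fun f => by
      cases f
      · exact ⟨0, rfl⟩
      · exact ⟨1, rfl⟩
      · exact ⟨2, rfl⟩

/-! ### Live states and the forced return to `(0, 1, irrelevant)` -/

/-- A finite set of states that the process never leaves under a truncated policy. -/
def liveStates (T : ℕ) : Set State :=
  {s | s.a ≤ T ∧ s.h ≤ T ∧ (s.fork ≠ .irrelevant → 1 ≤ s.h) ∧ (s.fork = .active → s.h ≤ s.a)}

lemma liveStates_finite (T : ℕ) : (liveStates T).Finite := by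
  refine (((Set.finite_Iic T).prod ((Set.finite_Iic T).prod
    (Set.finite_univ (α := Fork)))).image fun x => (⟨x.1, x.2.1, x.2.2⟩ : State)).subset ?_
  rintro ⟨a, h, f⟩ ⟨h1, h2, -⟩
  exact ⟨(a, h, f), ⟨h1, h2, trivial⟩, rfl⟩

lemma start_mem_liveStates {T : ℕ} (hT : 1 ≤ T) (b : Block) : start b ∈ liveStates T := by
  cases b <;> simp [start, liveStates, hT]

lemma next_mem_liveStates {T : ℕ} (hT : 1 ≤ T) {π : Policy} (hπ : π ∈ truncatedPolicies T)
    {s : State} (hs : s ∈ liveStates T) (b : Block) : next s (π s) b ∈ liveStates T := by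
  obtain ⟨hf, had⟩ := hπ s
  obtain ⟨h1, h2, h3, h4⟩ := hs
  have hlt : π s ≠ .adopt → s.a < T ∧ s.h < T := fun h => by
    by_contra hc
    exact h (had (by omega))
  obtain ⟨a, h, f⟩ := s
  cases hact : π ⟨a, h, f⟩
  · exact start_mem_liveStates hT b
  all_goals
    rw [hact] at hlt hf
    have hlt := hlt (by simp)
    cases b <;> cases f <;> simp_all [next, liveStates, race, extend, Feasible] <;> omega

lemma stateAt_mem_liveStates {T : ℕ} (hT : 1 ≤ T) {π : Policy} (hπ : π ∈ truncatedPolicies T)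
    (ω : ℕ → Block) (t : ℕ) : stateAt π ω t ∈ liveStates T := by
  induction t with
  | zero => exact start_mem_liveStates hT _
  | succ t ih => exact next_mem_liveStates hT hπ ih _

/-- An honest block decreases this potential, unless the attacker adopts. -/
lemma potential_next_lt {T : ℕ} {π : Policy} (hπ : π ∈ truncatedPolicies T)
    {s : State} (hs : s ∈ liveStates T) {b : Block} (hb : b ≠ .attacker) (hact : π s ≠ .adopt) :
    (T + 1) * (next s (π s) b).a + (T - (next s (π s) b).h) < (T + 1) * s.a + (T - s.h) := by
  obtain ⟨hf, had⟩ := hπ s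
  obtain ⟨h1, h2, h3, h4⟩ := hs
  have hlt : s.a < T ∧ s.h < T := by
    by_contra hc
    exact hact (had (by omega))
  obtain ⟨a, h, f⟩ := s
  -- The weight `T + 1` makes the loss of `k ≥ 1` attacker blocks outweigh the reset of `h` to 1. In
  -- a race `k = h`, and liveness supplies `1 ≤ h ≤ a`.
  have key : ∀ k, 1 ≤ k → k ≤ a → (T + 1) * (a - k) + (T - 1) < (T + 1) * a + (T - h) := by
    intro k hk hka
    obtain ⟨c, rfl⟩ := Nat.exists_eq_add_of_le hka
    have : T + 1 ≤ (T + 1) * k := Nat.le_mul_of_pos_right _ hk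
    rw [Nat.add_sub_cancel_left, Nat.mul_add]
    omega
  simp only at hlt h3 h4
  cases hact : π ⟨a, h, f⟩
  · contradiction
  all_goals
    rw [hact] at hf
    cases b <;> cases f <;> simp_all [next, race, extend, Feasible, Nat.sub_sub] <;> omega

/-- A property that is preserved by honest blocks of one kind propagates from any live state to
`(0, 1, irrelevant)`. -/
lemma start_of_honest_closed {T : ℕ} (hT : 1 ≤ T) {π : Policy} (hπ : π ∈ truncatedPolicies T)
    {b : Block} (hb : b ≠ .attacker) {p : State → Prop}
    (hp : ∀ s ∈ liveStates T, p s → p (next s (π s) b)) {s : State} (hs : s ∈ liveStates T)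
    (hps : p s) : p ⟨0, 1, .irrelevant⟩ := by
  induction hn : (T + 1) * s.a + (T - s.h) using Nat.strong_induction_on generalizing s with
  | _ n ih =>
    have h1 := hp s hs hps
    by_cases hact : π s = .adopt
    · rw [hact] at h1
      cases b
      · contradiction
      all_goals exact h1
    · exact ih _ (hn ▸ potential_next_lt hπ hs hb hact) (next_mem_liveStates hT hπ hs b) h1 rfl

/-! ### Maximum principle and Poisson equation -/

/-- The mean of a function of the creator of one block. -/
noncomputable def blockMean (α γ : Set.Icc (0 : ℝ) 1) (f : Block → ℝ) : ℝ :=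
  α * f .attacker + γ * (1 - α) * f .honestReached + (1 - γ) * (1 - α) * f .honestOther

lemma integral_blockLaw (α γ : Set.Icc (0 : ℝ) 1) (f : Block → ℝ) :
    ∫ b, f b ∂blockLaw α γ = blockMean α γ f := by
  have hint : ∀ μ : Measure Block, IsFiniteMeasure μ → Integrable f μ := fun μ _ =>
    Integrable.of_finite
  have h1 : 0 ≤ (γ : ℝ) * (1 - α) := mul_nonneg γ.2.1 (by linarith [α.2.2])
  have h2 : 0 ≤ (1 - (γ : ℝ)) * (1 - α) :=
    mul_nonneg (by linarith [γ.2.2]) (by linarith [α.2.2])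
  have hs : ∀ (c : ℝ) (x : Block),
      IsFiniteMeasure (ENNReal.ofReal c • Measure.dirac x) := fun c x =>
    ⟨by simp [Measure.smul_apply]⟩
  have := hs
  rw [blockLaw, integral_add_measure (hint _ inferInstance) (hint _ inferInstance),
    integral_add_measure (hint _ inferInstance) (hint _ inferInstance)]
  simp only [integral_smul_measure, integral_dirac, smul_eq_mul]
  rw [ENNReal.toReal_ofReal α.2.1, ENNReal.toReal_ofReal h1, ENNReal.toReal_ofReal h2]
  rfl

lemma blockMean_const (α γ : Set.Icc (0 : ℝ) 1) (c : ℝ) : blockMean α γ (fun _ => c) = c := by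
  simp only [blockMean]; ring

/-- A maximum principle: a subharmonic function of the live states is maximal at
`(0, 1, irrelevant)`. -/
lemma le_start_of_subharmonic {α γ : Set.Icc (0 : ℝ) 1} (hα : (α : ℝ) < 1) {T : ℕ} (hT : 1 ≤ T)
    {π : Policy} (hπ : π ∈ truncatedPolicies T) {u : State → ℝ}
    (hu : ∀ s ∈ liveStates T, u s ≤ blockMean α γ fun b => u (next s (π s) b)) :
    ∀ s ∈ liveStates T, u s ≤ u ⟨0, 1, .irrelevant⟩ := by
  obtain ⟨m, hm, hmax⟩ := (liveStates_finite T).exists_maximalFor u _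
    ⟨_, start_mem_liveStates hT .attacker⟩
  have hmax : ∀ s ∈ liveStates T, u s ≤ u m := fun s hs => by
    by_contra! h
    exact absurd (hmax hs h.le) (not_le.2 h)
  suffices h : u ⟨0, 1, .irrelevant⟩ = u m by rw [h]; exact hmax
  have hα0 := α.2.1
  have hγ0 := γ.2.1
  have hγ1 := γ.2.2
  have hγα : 0 ≤ (γ : ℝ) * (1 - α) := mul_nonneg hγ0 (by linarith)
  have hγα' : 0 ≤ (1 - (γ : ℝ)) * (1 - α) := mul_nonneg (by linarith) (by linarith)
  -- At a maximum point, a successor of positive probability is again a maximum point.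
  have key : ∀ s ∈ liveStates T, u s = u m →
      γ * (1 - α) * (u m - u (next s (π s) .honestReached)) ≤ 0 ∧
      (1 - γ) * (1 - α) * (u m - u (next s (π s) .honestOther)) ≤ 0 := by
    intro s hs hsm
    have h0 := hu s hs
    have hb : ∀ b, 0 ≤ u m - u (next s (π s) b) := fun b =>
      sub_nonneg.2 (hmax _ (next_mem_liveStates hT hπ hs b))
    have e1 := mul_nonneg hα0 (hb .attacker)
    have e2 := mul_nonneg hγα (hb .honestReached)
    have e3 := mul_nonneg hγα' (hb .honestOther)
    rw [hsm] at h0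
    simp only [blockMean] at h0
    constructor <;> nlinarith
  -- One kind of honest block must have positive probability: `honestOther` if `γ = 0`,
  -- `honestReached` if `γ > 0`.
  rcases eq_or_lt_of_le hγ0 with h | h
  · refine start_of_honest_closed hT hπ (b := .honestOther) (by simp) (p := fun s => u s = u m)
      (fun s hs hsm => ?_) hm rfl
    refine le_antisymm (hmax _ (next_mem_liveStates hT hπ hs _)) ?_
    exact sub_nonpos.1 (nonpos_of_mul_nonpos_right (key s hs hsm).2
      (mul_pos (by linarith) (by linarith)))
  · refine start_of_honest_closed hT hπ (b := .honestReached) (by simp) (p := fun s => u s = u m)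
      (fun s hs hsm => ?_) hm rfl
    refine le_antisymm (hmax _ (next_mem_liveStates hT hπ hs _)) ?_
    exact sub_nonpos.1 (nonpos_of_mul_nonpos_right (key s hs hsm).1
      (mul_pos h (by linarith)))

/-- Solvability of the Poisson equation of the chain of live states under a truncated policy. -/
lemma exists_poisson_solution {α γ : Set.Icc (0 : ℝ) 1} (hα : (α : ℝ) < 1) {T : ℕ} (hT : 1 ≤ T)
    {π : Policy} (hπ : π ∈ truncatedPolicies T) (r : State → ℝ) :
    ∃ (g : ℝ) (u : State → ℝ), ∀ s ∈ liveStates T,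
      r s = g + u s - blockMean α γ fun b => u (next s (π s) b) := by
  classical
  have := (liveStates_finite T).to_subtype
  have := Fintype.ofFinite (liveStates T)
  let s₀ : liveStates T := ⟨⟨0, 1, .irrelevant⟩, start_mem_liveStates hT .honestOther⟩
  let step : liveStates T → Block → liveStates T := fun s b =>
    ⟨next s (π s) b, next_mem_liveStates hT hπ s.2 b⟩
  -- The extra term `u s₀` removes the constants from the kernel of `1 - P`, with `P` the transition
  -- operator, and serves as the gain `g`.
  let L : (liveStates T → ℝ) →ₗ[ℝ] (liveStates T → ℝ) :=
    { toFun := fun u s => u s₀ + u s - blockMean α γ fun b => u (step s b)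
      map_add' := fun u v => by
        funext s; simp only [Pi.add_apply, blockMean]; ring
      map_smul' := fun c u => by
        funext s; simp only [Pi.smul_apply, smul_eq_mul, RingHom.id_apply, blockMean]; ring }
  let ext : (liveStates T → ℝ) → State → ℝ := fun u s => if hs : s ∈ liveStates T then u ⟨s, hs⟩
    else 0
  have hext : ∀ u (s : liveStates T), ext u s = u s := fun u s => by simp [ext]
  have hextn : ∀ u (s : liveStates T) b, ext u (next s (π s) b) = u (step s b) := fun u s b =>
    hext u (step s b)
  have hmax : ∀ u : liveStates T → ℝ, (∀ s, u s ≤ blockMean α γ fun b => u (step s b)) → ∀ s, u s ≤ u s₀ := by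
    intro u hu s
    have := le_start_of_subharmonic (u := ext u) hα hT hπ (fun s hs => by
      have := hu ⟨s, hs⟩
      rw [← hext u ⟨s, hs⟩] at this
      simpa only [← hextn u ⟨s, hs⟩] using this) s s.2
    rwa [hext, hext u s₀] at this
  -- Here `P u - u` is the constant `u s₀ ≥ 0`, so `u` is maximal at `s₀`, where `P u ≤ u` forces `u
  -- s₀ = 0`. Then `u` is harmonic, and the principle applied to `-u` gives `u = 0`.
  have hnonneg : ∀ u, L u = 0 → 0 ≤ u s₀ → u = 0 := by
    intro u hLu h0
    have hL : ∀ s, u s₀ + u s - (blockMean α γ fun b => u (step s b)) = 0 := congrFun hLu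
    have h1 := hmax u fun s => by linarith [hL s]
    have h2 : (blockMean α γ fun b => u (step s₀ b)) ≤ u s₀ := by
      have := integral_mono (μ := blockLaw α γ) Integrable.of_finite Integrable.of_finite
        (fun b => h1 (step s₀ b))
      rwa [integral_blockLaw, integral_blockLaw, blockMean_const] at this
    have h3 : u s₀ = 0 := by linarith [hL s₀]
    have hneg : ∀ s, (blockMean α γ fun b => (-u) (step s b)) =
        -(blockMean α γ fun b => u (step s b)) := fun s => by
      simp only [blockMean, Pi.neg_apply]; ring
    have h4 := hmax (-u) fun s => by
      rw [hneg]; simp only [Pi.neg_apply]; linarith [hL s]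
    funext s
    have := h4 s
    simp only [Pi.neg_apply] at this
    exact le_antisymm (by rw [Pi.zero_apply, ← h3]; exact h1 s) (by simp only [Pi.zero_apply]; linarith)
  have hinj : Function.Injective L := by
    rw [injective_iff_map_eq_zero]
    intro u hLu
    rcases le_total 0 (u s₀) with h | h
    · exact hnonneg u hLu h
    · exact neg_eq_zero.1 (hnonneg (-u) (by rw [map_neg, hLu, neg_zero]) (by simpa using h))
  obtain ⟨u, hu⟩ := LinearMap.injective_iff_surjective.1 hinj fun s => r s
  refine ⟨u s₀, ext u, fun s hs => ?_⟩
  have := congrFun hu ⟨s, hs⟩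
  rw [hext u ⟨s, hs⟩]
  simp only [hextn u ⟨s, hs⟩]
  exact this.symm

/-! ### Strong law of large numbers -/

instance (α γ : Set.Icc (0 : ℝ) 1) : IsProbabilityMeasure (blocksLaw α γ) := by
  unfold blocksLaw; infer_instance

lemma stateAt_congr (π : Policy) {t : ℕ} {ω ω' : ℕ → Block} (h : ∀ i ≤ t, ω i = ω' i) :
    stateAt π ω t = stateAt π ω' t := by
  induction t with
  | zero => simp [stateAt, h 0 le_rfl]
  | succ t ih => simp [stateAt, ih fun i hi => h i (by omega), h (t + 1) le_rfl]

/-- A function of finitely many blocks factors through a restriction. -/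
lemma exists_factor_restrict {t : ℕ} {F : (ℕ → Block) → ℝ}
    (hF : ∀ ω ω', (∀ i ≤ t, ω i = ω' i) → F ω = F ω') :
    ∃ F' : (Finset.Iic t → Block) → ℝ, F = fun ω => F' fun i => ω i := by
  refine ⟨fun x => F fun i => if h : i ∈ Finset.Iic t then x ⟨i, h⟩ else .attacker, ?_⟩
  funext ω
  exact hF _ _ fun i hi => by simp [hi]

lemma measurable_of_congr {t : ℕ} {F : (ℕ → Block) → ℝ}
    (hF : ∀ ω ω', (∀ i ≤ t, ω i = ω' i) → F ω = F ω') : Measurable F := by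
  obtain ⟨F', rfl⟩ := exists_factor_restrict hF
  exact (measurable_of_finite F').comp (by fun_prop)

/-- `F` depends on the blocks up to `t` only, hence is independent of block `t + 1`. -/
lemma integral_mul_next_block (α γ : Set.Icc (0 : ℝ) 1) {t : ℕ} {F : (ℕ → Block) → ℝ}
    (hF : ∀ ω ω', (∀ i ≤ t, ω i = ω' i) → F ω = F ω') (f : Block → ℝ) :
    ∫ ω, F ω * f (ω (t + 1)) ∂blocksLaw α γ =
      (∫ ω, F ω ∂blocksLaw α γ) * blockMean α γ f := by
  have hmeas := measurable_of_congr hF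
  obtain ⟨F', rfl⟩ := exists_factor_restrict hF
  have hind : ProbabilityTheory.iIndepFun (fun (i : ℕ) (ω : ℕ → Block) => ω i)
      (blocksLaw α γ) :=
    ProbabilityTheory.iIndepFun_infinitePi (X := fun _ b => b) (fun _ => measurable_id)
  have h1 := hind.indepFun_finset (Finset.Iic t) {t + 1} (by simp) (fun i => by fun_prop)
  have h2 : ProbabilityTheory.IndepFun (fun ω : ℕ → Block => F' fun i : Finset.Iic t => ω i)
      (fun ω => f (ω (t + 1))) (blocksLaw α γ) :=
    h1.comp (φ := F') (ψ := fun x : (({t + 1} : Finset ℕ) → Block) =>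
      f (x ⟨t + 1, Finset.mem_singleton_self _⟩))
      (measurable_of_finite _) (measurable_of_finite _)
  rw [h2.integral_fun_mul_eq_mul_integral hmeas.aestronglyMeasurable
    ((measurable_of_finite f).comp (measurable_pi_apply (t + 1))).aestronglyMeasurable,
    ← integral_blockLaw, ← (measurePreserving_eval_infinitePi (fun _ => blockLaw α γ)
      (t + 1)).map_eq, integral_map (measurable_pi_apply _).aemeasurable
      (measurable_of_finite f).aestronglyMeasurable]
  rfl

lemma integrable_of_congr (α γ : Set.Icc (0 : ℝ) 1) {t : ℕ} {F : (ℕ → Block) → ℝ}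
    (hF : ∀ ω ω', (∀ i ≤ t, ω i = ω' i) → F ω = F ω') : Integrable F (blocksLaw α γ) := by
  have hmeas := measurable_of_congr hF
  obtain ⟨F', rfl⟩ := exists_factor_restrict hF
  obtain ⟨C, hC⟩ := (Set.finite_range fun x => ‖F' x‖).bddAbove
  exact Integrable.of_bound hmeas.aestronglyMeasurable C
    (Eventually.of_forall fun ω => hC ⟨_, rfl⟩)

/-- A function of the past is orthogonal to a centred function of the current state and the next
block. -/
lemma integral_mul_centred_eq_zero (α γ : Set.Icc (0 : ℝ) 1) {T : ℕ} (hT : 1 ≤ T) {π : Policy}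
    (hπ : π ∈ truncatedPolicies T) {φ : State → Block → ℝ}
    (hφ : ∀ s ∈ liveStates T, blockMean α γ (φ s) = 0) {t : ℕ} {F : (ℕ → Block) → ℝ}
    (hF : ∀ ω ω', (∀ i ≤ t, ω i = ω' i) → F ω = F ω') :
    ∫ ω, F ω * φ (stateAt π ω t) (ω (t + 1)) ∂blocksLaw α γ = 0 := by
  classical
  let G := (liveStates_finite T).toFinset
  have hG : ∀ s, s ∈ G ↔ s ∈ liveStates T := fun s => (liveStates_finite T).mem_toFinset
  -- Splitting by the current state freezes `s` in `φ s`, so that only the next block remains random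
  -- in that factor.
  let Fs : State → (ℕ → Block) → ℝ := fun s ω => if stateAt π ω t = s then F ω else 0
  have hFs : ∀ s ω ω', (∀ i ≤ t, ω i = ω' i) → Fs s ω = Fs s ω' := fun s ω ω' h => by
    simp only [Fs, stateAt_congr π h, hF ω ω' h]
  have hsum : ∀ ω, F ω * φ (stateAt π ω t) (ω (t + 1)) =
      ∑ s ∈ G, Fs s ω * φ s (ω (t + 1)) := fun ω => by
    rw [Finset.sum_eq_single (stateAt π ω t)]
    · simp [Fs]
    · intro s _ hs
      simp [Fs, hs.symm]
    · intro h
      exact absurd ((hG _).2 (stateAt_mem_liveStates hT hπ ω t)) h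
  simp only [hsum]
  rw [integral_finsetSum]
  · refine Finset.sum_eq_zero fun s hs => ?_
    rw [integral_mul_next_block α γ (hFs s), hφ s ((hG s).1 hs), mul_zero]
  · intro s _
    refine integrable_of_congr α γ (t := t + 1) fun ω ω' h => ?_
    rw [hFs s ω ω' fun i hi => h i (by omega), h (t + 1) le_rfl]

lemma exists_bound_liveStates (T : ℕ) (φ : State → Block → ℝ) :
    ∃ C, 0 ≤ C ∧ ∀ s ∈ liveStates T, ∀ b, |φ s b| ≤ C := by
  obtain ⟨C, hC⟩ := (((liveStates_finite T).prod (Set.finite_univ (α := Block))).image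
    fun x => |φ x.1 x.2|).bddAbove
  have : ∀ s ∈ liveStates T, ∀ b, |φ s b| ≤ C := fun s hs b =>
    hC ⟨(s, b), ⟨hs, trivial⟩, rfl⟩
  exact ⟨max C 0, le_max_right _ _, fun s hs b => (this s hs b).trans (le_max_left _ _)⟩

/-- A sequence of partial sums of bounded terms that is `o(n)` along the squares is `o(n)`. -/
lemma tendsto_div_of_tendsto_div_sq {M : ℕ → ℝ} {C : ℝ} (hC : ∀ n, |M (n + 1) - M n| ≤ C)
    (h : Tendsto (fun k : ℕ => M (k ^ 2) / (k : ℝ) ^ 2) atTop (nhds 0)) :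
    Tendsto (fun n : ℕ => M n / n) atTop (nhds 0) := by
  have hC0 : 0 ≤ C := (abs_nonneg _).trans (hC 0)
  have hgap : ∀ n k, |M (n + k) - M n| ≤ C * k := by
    intro n k
    induction k with
    | zero => simp
    | succ k ih =>
      have := abs_sub_le (M (n + (k + 1))) (M (n + k)) (M n)
      have h2 := hC (n + k)
      rw [← add_assoc] at this ⊢
      push_cast
      linarith
  have hsqrt : Tendsto Nat.sqrt atTop atTop :=
    tendsto_atTop.2 fun b => (eventually_ge_atTop (b * b)).mono fun n hn => Nat.le_sqrt.2 hn
  -- For `k = ⌊√n⌋` one has `n - k² ≤ 2k`, so `M n` and `M (k²)` differ by at most `2Ck`.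
  have h1 : Tendsto (fun n : ℕ => |M (n.sqrt ^ 2) / (n.sqrt : ℝ) ^ 2| + 2 * C / n.sqrt)
      atTop (nhds 0) := by
    have e1 := (h.comp hsqrt).abs
    have e2 : Tendsto (fun n : ℕ => 2 * C / (n.sqrt : ℝ)) atTop (nhds 0) :=
      (tendsto_const_nhds.div_atTop (tendsto_natCast_atTop_atTop)).comp hsqrt
    simpa using e1.add e2
  refine squeeze_zero_norm' ?_ h1
  filter_upwards [eventually_ge_atTop 1] with n hn
  have hk1 : 1 ≤ n.sqrt := Nat.le_sqrt.2 (by omega)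
  have hle : n.sqrt ^ 2 ≤ n := by rw [pow_two]; exact Nat.sqrt_le n
  have hlt : n ≤ n.sqrt ^ 2 + 2 * n.sqrt := by
    have := Nat.sqrt_le_add n
    nlinarith
  generalize n.sqrt = k at *
  obtain ⟨j, rfl⟩ := Nat.exists_eq_add_of_le hle
  have hj : (j : ℝ) ≤ 2 * k := by exact_mod_cast (by omega : j ≤ 2 * k)
  have hkpos : (0 : ℝ) < k := by exact_mod_cast hk1
  have hnk : (k : ℝ) ^ 2 ≤ ((k ^ 2 + j : ℕ) : ℝ) := by push_cast; linarith [j.cast_nonneg (α := ℝ)]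
  have hM : |M (k ^ 2 + j)| ≤ |M (k ^ 2)| + C * (2 * k) := by
    have e := hgap (k ^ 2) j
    have e2 := abs_sub_abs_le_abs_sub (M (k ^ 2 + j)) (M (k ^ 2))
    nlinarith [mul_le_mul_of_nonneg_left hj hC0]
  rw [Real.norm_eq_abs, abs_div, Nat.abs_cast, abs_div, abs_of_pos (pow_pos hkpos 2)]
  calc |M (k ^ 2 + j)| / ((k ^ 2 + j : ℕ) : ℝ) ≤ (|M (k ^ 2)| + C * (2 * k)) / (k : ℝ) ^ 2 := by
        gcongr
    _ = _ := by field_simp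

/-- The strong law of large numbers for centred functions of the current state and the next
block. -/
lemma ae_tendsto_centred_average (α γ : Set.Icc (0 : ℝ) 1) {T : ℕ} (hT : 1 ≤ T) {π : Policy}
    (hπ : π ∈ truncatedPolicies T) {φ : State → Block → ℝ}
    (hφ : ∀ s ∈ liveStates T, blockMean α γ (φ s) = 0) :
    ∀ᵐ ω ∂blocksLaw α γ, Tendsto
      (fun n : ℕ => (∑ t ∈ Finset.range n, φ (stateAt π ω t) (ω (t + 1))) / (n : ℝ))
      atTop (nhds 0) := by
  obtain ⟨C, hC0, hC⟩ := exists_bound_liveStates T φ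
  set M : ℕ → (ℕ → Block) → ℝ := fun n ω =>
    ∑ t ∈ Finset.range n, φ (stateAt π ω t) (ω (t + 1)) with hMdef
  have hMcongr : ∀ n ω ω', (∀ i ≤ n, ω i = ω' i) → M n ω = M n ω' := fun n ω ω' h =>
    Finset.sum_congr rfl fun t ht => by
      rw [stateAt_congr π fun i hi => h i (by have := Finset.mem_range.1 ht; omega),
        h (t + 1) (by have := Finset.mem_range.1 ht; omega)]
  have hφC : ∀ ω t, |φ (stateAt π ω t) (ω (t + 1))| ≤ C := fun ω t =>
    hC _ (stateAt_mem_liveStates hT hπ ω t) _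
  -- Increments are orthogonal to the past, so second moments grow linearly.
  have hsq : ∀ n, ∫ ω, (M n ω) ^ 2 ∂blocksLaw α γ ≤ C ^ 2 * n := by
    intro n
    induction n with
    | zero => simp [hMdef]
    | succ n ih =>
      have hcongr : ∀ ω ω' : ℕ → Block, (∀ i ≤ n + 1, ω i = ω' i) →
          φ (stateAt π ω n) (ω (n + 1)) = φ (stateAt π ω' n) (ω' (n + 1)) := fun ω ω' h => by
        rw [stateAt_congr π fun i hi => h i (by omega), h (n + 1) le_rfl]
      have hM' : ∀ ω ω' : ℕ → Block, (∀ i ≤ n + 1, ω i = ω' i) → M n ω = M n ω' :=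
        fun ω ω' h => hMcongr n ω ω' fun i hi => h i (by omega)
      have i1 : Integrable (fun ω => (M n ω) ^ 2) (blocksLaw α γ) :=
        integrable_of_congr α γ (t := n + 1) fun ω ω' h => by rw [hM' ω ω' h]
      have i2 : Integrable (fun ω => (2 * M n ω) * φ (stateAt π ω n) (ω (n + 1)))
          (blocksLaw α γ) :=
        integrable_of_congr α γ (t := n + 1) fun ω ω' h => by rw [hM' ω ω' h, hcongr ω ω' h]
      have i3 : Integrable (fun ω => (φ (stateAt π ω n) (ω (n + 1))) ^ 2) (blocksLaw α γ) :=
        integrable_of_congr α γ (t := n + 1) fun ω ω' h => by rw [hcongr ω ω' h]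
      have hz := integral_mul_centred_eq_zero α γ hT hπ hφ (t := n) (F := fun ω => 2 * M n ω)
        fun ω ω' h => by rw [hMcongr n ω ω' h]
      have hle : ∫ ω, (φ (stateAt π ω n) (ω (n + 1))) ^ 2 ∂blocksLaw α γ ≤ C ^ 2 := by
        have := integral_mono i3 (integrable_const (C ^ 2)) fun ω => by
          have := hφC ω n
          simpa [sq_abs] using pow_le_pow_left₀ (abs_nonneg _) this 2
        simpa using this
      have hexp : ∀ ω, (M (n + 1) ω) ^ 2 = (M n ω) ^ 2 +
          (2 * M n ω) * φ (stateAt π ω n) (ω (n + 1)) + (φ (stateAt π ω n) (ω (n + 1))) ^ 2 :=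
        fun ω => by simp only [hMdef, Finset.sum_range_succ]; ring
      simp only [hexp]
      have hadd := integral_add (i1.add i2) i3
      have hadd' := integral_add i1 i2
      simp only [Pi.add_apply] at hadd hadd'
      rw [hadd, hadd', hz]
      push_cast
      linarith
  have hint : ∀ k : ℕ, Integrable (fun ω => (M (k ^ 2) ω / (k : ℝ) ^ 2) ^ 2) (blocksLaw α γ) :=
    fun k => integrable_of_congr α γ (t := k ^ 2) fun ω ω' h => by
      rw [hMcongr (k ^ 2) ω ω' h]
  have hbound : ∀ k : ℕ, ∫ ω, (M (k ^ 2) ω / (k : ℝ) ^ 2) ^ 2 ∂blocksLaw α γ ≤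
      C ^ 2 * (1 / (k : ℝ) ^ 2) := by
    intro k
    rcases Nat.eq_zero_or_pos k with rfl | hk
    · simp
    have hk' : (0 : ℝ) < k := by exact_mod_cast hk
    simp only [div_pow]
    rw [integral_div, div_le_iff₀ (by positivity)]
    refine (hsq (k ^ 2)).trans_eq ?_
    push_cast
    field_simp
  -- Along the squares the second moments are at most `C² / k²`; the summed squares have finite
  -- mean, so almost surely they are summable and tend to 0.
  have hsummable : Summable fun k : ℕ =>
      ∫ ω, (M (k ^ 2) ω / (k : ℝ) ^ 2) ^ 2 ∂blocksLaw α γ :=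
    Summable.of_nonneg_of_le (fun k => integral_nonneg fun ω => sq_nonneg _) hbound
      ((Real.summable_one_div_nat_pow.2 one_lt_two).mul_left _)
  have hfin : ∫⁻ ω, ∑' k : ℕ, ENNReal.ofReal ((M (k ^ 2) ω / (k : ℝ) ^ 2) ^ 2) ∂blocksLaw α γ
      ≠ ⊤ := by
    rw [lintegral_tsum fun k => (hint k).1.aemeasurable.ennreal_ofReal]
    simp only [← ofReal_integral_eq_lintegral_ofReal (hint _)
      (Eventually.of_forall fun ω => sq_nonneg _)]
    exact hsummable.tsum_ofReal_ne_top
  have hae := ae_lt_top' (AEMeasurable.tsum fun k =>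
    (hint k).1.aemeasurable.ennreal_ofReal) hfin
  filter_upwards [hae] with ω hω
  refine tendsto_div_of_tendsto_div_sq (M := fun n => M n ω) (C := C) (fun n => ?_) ?_
  · simpa [hMdef, Finset.sum_range_succ] using hφC ω n
  · have h1 := ENNReal.tendsto_atTop_zero_of_tsum_ne_top hω.ne
    have h2 := (ENNReal.tendsto_toReal ENNReal.zero_ne_top).comp h1
    have h3 : Tendsto (fun k : ℕ => (M (k ^ 2) ω / (k : ℝ) ^ 2) ^ 2) atTop (nhds 0) := by
      refine h2.congr fun k => ?_
      simp [ENNReal.toReal_ofReal (sq_nonneg _)]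
    have h4 := h3.sqrt
    rw [Real.sqrt_zero] at h4
    refine (tendsto_zero_iff_abs_tendsto_zero _).2 (h4.congr fun k => ?_)
    simp [Real.sqrt_sq_eq_abs]

lemma tendsto_add_bounded_div {A B : ℕ → ℝ} {C g : ℝ} (hB : ∀ n, |B n| ≤ C)
    (hA : Tendsto (fun n : ℕ => A n / n) atTop (nhds g)) :
    Tendsto (fun n : ℕ => (A n + B n) / n) atTop (nhds g) := by
  have h : Tendsto (fun n : ℕ => B n / n) atTop (nhds 0) := by
    refine squeeze_zero_norm (fun n => ?_)
      (tendsto_const_nhds.div_atTop tendsto_natCast_atTop_atTop : Tendsto (fun n : ℕ => C / n) _ _)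
    rw [Real.norm_eq_abs, abs_div, Nat.abs_cast]
    gcongr
    exact hB n
  simpa [add_div] using hA.add h

lemma sum_Icc_one_eq (f : ℕ → ℝ) (n : ℕ) :
    ∑ t ∈ Finset.Icc 1 n, f t = ∑ t ∈ Finset.range n, f t + (f n - f 0) := by
  induction n with
  | zero => simp
  | succ n ih =>
    rw [Finset.sum_Icc_succ_top (by omega), ih, Finset.sum_range_succ]
    ring

/-- By the Poisson equation `r - g + u(next) - u` is centred in each live state; the `u` terms
telescope to a bounded remainder. -/
lemma ae_tendsto_average_of_poisson {α γ : Set.Icc (0 : ℝ) 1} {T : ℕ} (hT : 1 ≤ T) {π : Policy}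
    (hπ : π ∈ truncatedPolicies T) {r : State → Block → ℝ} {g : ℝ} {u : State → ℝ}
    (hu : ∀ s ∈ liveStates T,
      blockMean α γ (r s) = g + u s - blockMean α γ fun b => u (next s (π s) b)) :
    ∀ᵐ ω ∂blocksLaw α γ, Tendsto
      (fun n : ℕ => (∑ t ∈ Finset.Icc 1 n, r (stateAt π ω t) (ω (t + 1))) / (n : ℝ))
      atTop (nhds g) := by
  have h := ae_tendsto_centred_average α γ hT hπ
    (φ := fun s b => r s b - g + u (next s (π s) b) - u s) fun s hs => by
      have := hu s hs
      simp only [blockMean] at this ⊢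
      linarith
  obtain ⟨C, hC0, hC⟩ := exists_bound_liveStates T r
  obtain ⟨D, hD0, hD⟩ := exists_bound_liveStates T fun s _ => u s
  filter_upwards [h] with ω hω
  have hX := stateAt_mem_liveStates hT hπ ω
  have hsum : ∀ n : ℕ, ∑ t ∈ Finset.Icc 1 n, r (stateAt π ω t) (ω (t + 1)) =
      (∑ t ∈ Finset.range n, (r (stateAt π ω t) (ω (t + 1)) - g
        + u (next (stateAt π ω t) (π (stateAt π ω t)) (ω (t + 1))) - u (stateAt π ω t)) + n * g)
      + (r (stateAt π ω n) (ω (n + 1)) - r (stateAt π ω 0) (ω (0 + 1))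
        + u (stateAt π ω 0) - u (stateAt π ω n)) := by
    intro n
    rw [sum_Icc_one_eq fun t => r (stateAt π ω t) (ω (t + 1))]
    have htel : ∑ t ∈ Finset.range n, (r (stateAt π ω t) (ω (t + 1)) - g
        + u (next (stateAt π ω t) (π (stateAt π ω t)) (ω (t + 1))) - u (stateAt π ω t)) =
        ∑ t ∈ Finset.range n, r (stateAt π ω t) (ω (t + 1)) - n * g
          + (u (stateAt π ω n) - u (stateAt π ω 0)) := by
      induction n with
      | zero => simp
      | succ n ih =>
        rw [Finset.sum_range_succ, ih, Finset.sum_range_succ]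
        simp only [stateAt]
        push_cast
        ring
    rw [htel]
    ring
  simp only [hsum]
  refine tendsto_add_bounded_div (C := C + C + D + D) (fun n => ?_) ?_
  · have h1 := abs_le.1 (hC _ (hX n) (ω (n + 1)))
    have h2 := abs_le.1 (hC _ (hX 0) (ω (0 + 1)))
    have h3 := abs_le.1 (hD _ (hX n) (ω 0))
    have h4 := abs_le.1 (hD _ (hX 0) (ω 0))
    rw [abs_le]
    constructor <;> linarith [h1.1, h1.2, h2.1, h2.2, h3.1, h3.2, h4.1, h4.2]
  · have h2 := hω.add_const g
    rw [zero_add] at h2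
    refine h2.congr' ?_
    filter_upwards [eventually_ge_atTop 1] with n hn
    have : (n : ℝ) ≠ 0 := by positivity
    field_simp

/-- The strong law of large numbers for rewards: the average reward converges almost surely to a
constant. -/
lemma exists_ae_tendsto_average {α γ : Set.Icc (0 : ℝ) 1} (hα : (α : ℝ) < 1) {T : ℕ} (hT : 1 ≤ T)
    {π : Policy} (hπ : π ∈ truncatedPolicies T) (r : State → Block → ℝ) :
    ∃ g : ℝ, ∀ᵐ ω ∂blocksLaw α γ, Tendsto
      (fun n : ℕ => (∑ t ∈ Finset.Icc 1 n, r (stateAt π ω t) (ω (t + 1))) / (n : ℝ))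
      atTop (nhds g) := by
  obtain ⟨g, u, hu⟩ := exists_poisson_solution hα hT hπ fun s => blockMean α γ (r s)
  exact ⟨g, ae_tendsto_average_of_poisson hT hπ hu⟩

/-! ### Rates of accepted blocks and the value identity -/

/-- The indicator of honest blocks. -/
def honestCount : Block → ℕ
  | .attacker => 0
  | _ => 1

/-- The public chain grows at least by one with every honest block. -/
lemma honestCount_add_le {T : ℕ} {π : Policy} (hπ : π ∈ truncatedPolicies T) (s : State)
    (b : Block) : honestCount b + s.h ≤
      (reward s (π s) b).1 + (reward s (π s) b).2 + (next s (π s) b).h := by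
  have hf := (hπ s).1
  obtain ⟨a, h, f⟩ := s
  cases hact : π ⟨a, h, f⟩ <;> cases b <;> cases f <;>
    simp [next, reward, race, raceReward, extend, start, honestCount] <;> omega

/-- The total number of blocks grows at most by one in a step. -/
lemma reward_add_max_le {T : ℕ} {π : Policy} (hπ : π ∈ truncatedPolicies T) {s : State}
    (hs : s ∈ liveStates T) (b : Block) :
    (reward s (π s) b).1 + (reward s (π s) b).2 + max (next s (π s) b).a (next s (π s) b).h ≤
      1 + max s.a s.h := by
  have hf := (hπ s).1
  obtain ⟨-, -, -, h4⟩ := hs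
  obtain ⟨a, h, f⟩ := s
  cases hact : π ⟨a, h, f⟩ <;> rw [hact] at hf <;> cases b <;> cases f <;>
    simp_all [next, reward, race, raceReward, extend, start, Feasible] <;> omega

lemma sum_honestCount_le {T : ℕ} {π : Policy} (hπ : π ∈ truncatedPolicies T) (ω : ℕ → Block)
    (n : ℕ) : ∑ t ∈ Finset.Icc 1 n, honestCount (ω (t + 1)) ≤
      ∑ t ∈ Finset.Icc 1 n, ((rewardAt π ω t).1 + (rewardAt π ω t).2)
        + (stateAt π ω (n + 1)).h := by
  induction n with
  | zero => simp
  | succ n ih =>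
    rw [Finset.sum_Icc_succ_top (by omega), Finset.sum_Icc_succ_top (by omega)]
    have := honestCount_add_le hπ (stateAt π ω (n + 1)) (ω (n + 1 + 1))
    simp only [rewardAt, stateAt] at *
    omega

lemma sum_reward_le {T : ℕ} (hT : 1 ≤ T) {π : Policy} (hπ : π ∈ truncatedPolicies T)
    (ω : ℕ → Block) (n : ℕ) :
    ∑ t ∈ Finset.Icc 1 n, ((rewardAt π ω t).1 + (rewardAt π ω t).2)
      + max (stateAt π ω (n + 1)).a (stateAt π ω (n + 1)).h ≤
      n + max (stateAt π ω 1).a (stateAt π ω 1).h := by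
  induction n with
  | zero => simp
  | succ n ih =>
    rw [Finset.sum_Icc_succ_top (by omega)]
    have := reward_add_max_le hπ (stateAt_mem_liveStates hT hπ ω (n + 1)) (ω (n + 1 + 1))
    simp only [rewardAt, stateAt] at *
    omega

/-- The rates at which blocks of the attacker and of the honest nodes are accepted. -/
lemma exists_rates {α γ : Set.Icc (0 : ℝ) 1} (hα : (α : ℝ) ≤ 1 / 2) {T : ℕ} (hT : 1 ≤ T)
    {π : Policy} (hπ : π ∈ truncatedPolicies T) :
    ∃ g₁ g₂ : ℝ, 0 ≤ g₁ ∧ 0 ≤ g₂ ∧ 1 / 2 ≤ g₁ + g₂ ∧ g₁ + g₂ ≤ 1 ∧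
      ∀ᵐ ω ∂blocksLaw α γ,
        Tendsto (fun n : ℕ => (∑ t ∈ Finset.Icc 1 n, ((rewardAt π ω t).1 : ℝ)) / (n : ℝ))
          atTop (nhds g₁) ∧
        Tendsto (fun n : ℕ => (∑ t ∈ Finset.Icc 1 n, ((rewardAt π ω t).2 : ℝ)) / (n : ℝ))
          atTop (nhds g₂) := by
  obtain ⟨g₁, h₁⟩ := exists_ae_tendsto_average (γ := γ) (by linarith : (α : ℝ) < 1) hT hπ
    fun s b => ((reward s (π s) b).1 : ℝ)
  obtain ⟨g₂, h₂⟩ := exists_ae_tendsto_average (γ := γ) (by linarith : (α : ℝ) < 1) hT hπ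
    fun s b => ((reward s (π s) b).2 : ℝ)
  -- The frequency of honest blocks is independent of the state, so `u = 0` solves its Poisson
  -- equation.
  have h₃ := ae_tendsto_average_of_poisson (α := α) (γ := γ) hT hπ
    (r := fun _ b => (honestCount b : ℝ)) (g := 1 - α) (u := fun _ => 0) fun s _ => by
      simp [blockMean, honestCount]; ring
  -- The limits are constants, so one sample path suffices to compare them.
  obtain ⟨ω, ⟨h₁ω, h₂ω⟩, h₃ω⟩ := ((h₁.and h₂).and h₃).exists
  have hsum := h₁ω.add h₂ω
  simp only [← add_div, ← Finset.sum_add_distrib] at hsum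
  have hX := stateAt_mem_liveStates hT hπ ω
  refine ⟨g₁, g₂, ge_of_tendsto' h₁ω fun n => by positivity,
    ge_of_tendsto' h₂ω fun n => by positivity, ?_, ?_, h₁.and h₂⟩
  · have h := tendsto_add_bounded_div (B := fun n => ((stateAt π ω (n + 1)).h : ℝ)) (C := T)
      (fun n => by rw [Nat.abs_cast]; exact_mod_cast (hX (n + 1)).2.1) hsum
    have := le_of_tendsto_of_tendsto' h₃ω h fun n => by
      gcongr
      exact_mod_cast sum_honestCount_le hπ ω n
    linarith
  · have h : Tendsto (fun n : ℕ => ((n : ℝ) + (T : ℝ)) / n) atTop (nhds 1) := by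
      refine tendsto_add_bounded_div (A := fun n => (n : ℝ)) (B := fun _ => (T : ℝ)) (C := T)
        (fun n => by rw [Nat.abs_cast]) ?_
      refine tendsto_const_nhds.congr' ?_
      filter_upwards [eventually_ge_atTop 1] with n hn
      rw [div_self (by positivity)]
    refine le_of_tendsto_of_tendsto' hsum h fun n => ?_
    have h1 := sum_reward_le hT hπ ω n
    have h2 : max (stateAt π ω 1).a (stateAt π ω 1).h ≤ T := max_le (hX 1).1 (hX 1).2.1
    have h3 : ∑ t ∈ Finset.Icc 1 n, ((rewardAt π ω t).1 + (rewardAt π ω t).2) ≤ n + T := by omega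
    gcongr
    exact_mod_cast h3

/-- The value is proportional to the difference of the relative revenue and `ρ`, with the rate of
accepted blocks as the factor. -/
lemma exists_value_eq {α γ : Set.Icc (0 : ℝ) 1} (hα : (α : ℝ) ≤ 1 / 2) {T : ℕ} (hT : 1 ≤ T)
    {π : Policy} (hπ : π ∈ truncatedPolicies T) :
    ∃ g : ℝ, 1 / 2 ≤ g ∧ g ≤ 1 ∧ 0 ≤ REV α γ π ∧ REV α γ π ≤ 1 ∧
      ∀ ρ, value α γ ρ π = g * (REV α γ π - ρ) := by
  obtain ⟨g₁, g₂, h₁, h₂, hlo, hhi, hae⟩ := exists_rates (γ := γ) hα hT hπ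
  have hg : 0 < g₁ + g₂ := by linarith
  have hREV : REV α γ π = g₁ / (g₁ + g₂) := by
    have : ∀ᵐ ω ∂blocksLaw α γ, liminf (fun T : ℕ =>
        (∑ t ∈ Finset.Icc 1 T, ((rewardAt π ω t).1 : ℝ)) /
          ∑ t ∈ Finset.Icc 1 T, (((rewardAt π ω t).1 : ℝ) + (rewardAt π ω t).2)) atTop
        = g₁ / (g₁ + g₂) := by
      filter_upwards [hae] with ω ⟨e₁, e₂⟩
      refine Tendsto.liminf_eq ((e₁.div (e₁.add e₂) hg.ne').congr' ?_)
      filter_upwards [eventually_ge_atTop 1] with n hn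
      have : (n : ℝ) ≠ 0 := by positivity
      simp only [Pi.div_apply]
      rw [← add_div, div_div_div_cancel_right₀ this, Finset.sum_add_distrib]
    rw [REV, integral_congr_ae this]
    simp
  refine ⟨g₁ + g₂, hlo, hhi, hREV ▸ by positivity, ?_, fun ρ => ?_⟩
  · rw [hREV, div_le_one hg]; linarith
  · have : ∀ᵐ ω ∂blocksLaw α γ, liminf (fun T : ℕ =>
        (1 / (T : ℝ)) * ∑ t ∈ Finset.Icc 1 T, w ρ (rewardAt π ω t)) atTop
        = (1 - ρ) * g₁ - ρ * g₂ := by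
      filter_upwards [hae] with ω ⟨e₁, e₂⟩
      refine Tendsto.liminf_eq (((e₁.const_mul (1 - ρ)).sub (e₂.const_mul ρ)).congr fun n => ?_)
      simp only [w, Finset.sum_sub_distrib, ← Finset.mul_sum]
      ring
    rw [value, integral_congr_ae this, hREV]
    simp only [integral_const, probReal_univ, one_smul]
    field_simp
    ring

/-! ### Existence of the maximum and of a solver -/

lemma REV_congr (α γ : Set.Icc (0 : ℝ) 1) {T : ℕ} (hT : 1 ≤ T) {π π' : Policy}
    (hπ : π ∈ truncatedPolicies T) (h : ∀ s ∈ liveStates T, π s = π' s) :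
    REV α γ π = REV α γ π' := by
  have hst : ∀ ω t, stateAt π ω t = stateAt π' ω t := by
    intro ω t
    induction t with
    | zero => rfl
    | succ t ih =>
      have := h _ (stateAt_mem_liveStates hT hπ ω t)
      simp only [stateAt]
      rw [this, ih]
  have hr : ∀ ω t, rewardAt π ω t = rewardAt π' ω t := fun ω t => by
    simp only [rewardAt]
    rw [h _ (stateAt_mem_liveStates hT hπ ω t), hst]
  simp only [REV, hr]

lemma finite_image_REV (α γ : Set.Icc (0 : ℝ) 1) {T : ℕ} (hT : 1 ≤ T) :
    (REV α γ '' truncatedPolicies T).Finite := by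
  classical
  have := (liveStates_finite T).to_subtype
  -- By `REV_congr` the choice of the extension of `x` is immaterial; the value 0 where none exists
  -- only enlarges the range.
  let G : (liveStates T → Action) → ℝ := fun x =>
    if h : ∃ π ∈ truncatedPolicies T, ∀ s : liveStates T, π s = x s then REV α γ h.choose else 0
  refine (Set.finite_range G).subset ?_
  rintro _ ⟨π, hπ, rfl⟩
  have h : ∃ π' ∈ truncatedPolicies T, ∀ s : liveStates T, π' s = π s := ⟨π, hπ, fun _ => rfl⟩
  refine ⟨fun s => π s, ?_⟩
  simp only [G, dif_pos h]
  exact REV_congr α γ hT h.choose_spec.1 fun s hs => h.choose_spec.2 ⟨s, hs⟩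

lemma truncatedPolicies_nonempty (T : ℕ) : (truncatedPolicies T).Nonempty :=
  ⟨fun _ => .adopt, fun _ => ⟨trivial, fun _ => rfl⟩⟩

lemma exists_isGreatest_REV (α γ : Set.Icc (0 : ℝ) 1) {T : ℕ} (hT : 1 ≤ T) :
    ∃ m, IsGreatest (REV α γ '' truncatedPolicies T) m :=
  (finite_image_REV α γ hT).isCompact.exists_isGreatest
    ((truncatedPolicies_nonempty T).image _)

/-- Values are at most 1 for `ρ ≥ 0`, so their supremum is finite and is approached within `δ`. -/
lemma exists_isMDPSolver {α : Set.Icc (0 : ℝ) 1} (γ : Set.Icc (0 : ℝ) 1) (hα : (α : ℝ) ≤ 1 / 2)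
    {T : ℕ} (hT : 1 ≤ T) : ∃ solver, IsMDPSolver α γ T solver := by
  have key : ∀ ρ δ : ℝ, ∃ p : Policy × ℝ, ρ ∈ Set.Icc (0 : ℝ) 1 → 0 < δ →
      IsApproxOptimal α γ T ρ δ p.1 ∧ p.2 = value α γ ρ p.1 := by
    intro ρ δ
    by_cases h : ρ ∈ Set.Icc (0 : ℝ) 1 ∧ 0 < δ
    · obtain ⟨hρ, hδ⟩ := h
      have hbdd : BddAbove (value α γ ρ '' truncatedPolicies T) := by
        refine ⟨1, ?_⟩
        rintro _ ⟨π, hπ, rfl⟩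
        obtain ⟨g, hg, hg1, h0, h1, hv⟩ := exists_value_eq (γ := γ) hα hT hπ
        rw [hv]
        exact (mul_le_mul_of_nonneg_left (by linarith [hρ.1]) (by linarith)).trans
          (by linarith : g * 1 ≤ 1)
      obtain ⟨_, ⟨π, hπ, rfl⟩, hlt⟩ := exists_lt_of_lt_csSup
        ((truncatedPolicies_nonempty T).image (value α γ ρ))
        (sub_lt_self (sSup (value α γ ρ '' truncatedPolicies T)) hδ)
      refine ⟨(π, value α γ ρ π), fun _ _ => ⟨⟨hπ, fun π' hπ' => ?_⟩, rfl⟩⟩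
      have := le_csSup hbdd ⟨π', hπ', rfl⟩
      linarith
    · exact ⟨(fun _ => .adopt, 0), fun h1 h2 => absurd ⟨h1, h2⟩ h⟩
  choose solver hsolver using key
  exact ⟨solver, fun ρ hρ δ hδ => hsolver ρ δ hρ hδ⟩

/-! ### Binary search -/

lemma loopBody_width (solver : ℝ → ℝ → Policy × ℝ) (ε : ℝ) (s : Segment) :
    (loopBody solver ε s).high - (loopBody solver ε s).low = (s.high - s.low) / 2 := by
  unfold loopBody Segment.mid
  split_ifs <;> simp only <;> ring

lemma iterate_loopBody_width (solver : ℝ → ℝ → Policy × ℝ) (ε : ℝ) (n : ℕ) :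
    ((loopBody solver ε)^[n] ⟨0, 1⟩).high - ((loopBody solver ε)^[n] ⟨0, 1⟩).low
      = (1 / 2) ^ n := by
  induction n with
  | zero => simp
  | succ n ih => rw [Function.iterate_succ_apply', loopBody_width, ih]; ring

/-- One call of the solver either finds a policy of relative revenue above `ρ`, or shows that
the maximal relative revenue is hardly above `ρ` and that the policy is hardly below it. -/
lemma solver_dichotomy {α γ : Set.Icc (0 : ℝ) 1} (hα : (α : ℝ) ≤ 1 / 2) {T : ℕ} (hT : 1 ≤ T)
    {ε : ℝ} (hε : 0 < ε) {solver : ℝ → ℝ → Policy × ℝ} (hsolver : IsMDPSolver α γ T solver)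
    {m : ℝ} (hm : IsGreatest (REV α γ '' truncatedPolicies T) m) {ρ : ℝ}
    (hρ : ρ ∈ Set.Icc (0 : ℝ) 1) :
    (0 < (solver ρ (ε / 8)).2 → ρ < REV α γ (solver ρ (ε / 8)).1) ∧
    (¬ 0 < (solver ρ (ε / 8)).2 → m ≤ ρ + ε / 4 ∧ REV α γ (solver ρ (ε / 8)).1 ≤ ρ ∧
      (ρ - ε / 8 ≤ m → ρ - ε / 2 ≤ REV α γ (solver ρ (ε / 8)).1)) := by
  obtain ⟨⟨hπ, hopt⟩, hv⟩ := hsolver ρ hρ (ε / 8) (by positivity)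
  rw [hv]
  generalize (solver ρ (ε / 8)).1 = π at *
  obtain ⟨g, hg, hg1, -, -, hval⟩ := exists_value_eq (γ := γ) hα hT hπ
  obtain ⟨π', hπ', rfl⟩ := hm.1
  obtain ⟨g', hg', hg1', -, -, hval'⟩ := exists_value_eq (γ := γ) hα hT hπ'
  have hle := hopt π' hπ'
  rw [hval] at hle ⊢
  rw [hval'] at hle
  refine ⟨fun h => sub_pos.1 (pos_of_mul_pos_right h (by linarith)), fun h => ?_⟩
  have h := not_lt.1 h
  refine ⟨?_, sub_nonpos.1 (nonpos_of_mul_nonpos_right h (by linarith)), fun hlow => ?_⟩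
  -- Near-optimality gives `g' (m - ρ) ≤ ε/8`, and `g' ≥ 1/2` doubles the error.
  · by_contra! hc
    nlinarith
  -- From `g' ≤ 1` follows `g' (m - ρ) ≥ -ε/8`, hence `g (REV π - ρ) ≥ -ε/4`; then `g ≥ 1/2` is
  -- used.
  · by_contra! hc
    nlinarith

/-- The invariant of the binary search for the maximal relative revenue `m`. -/
structure Segment.Brackets (s : Segment) (ε m : ℝ) : Prop where
  zero_le : 0 ≤ s.low
  low_le_high : s.low ≤ s.high
  high_le : s.high ≤ 1
  low_le : s.low ≤ m
  le_high : m ≤ s.high + ε / 4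

lemma Segment.Brackets.mid_mem {s : Segment} {ε m : ℝ} (hs : s.Brackets ε m) :
    s.mid ∈ Set.Icc (0 : ℝ) 1 := by
  obtain ⟨h1, h2, h3, -, -⟩ := hs
  unfold Segment.mid
  constructor <;> linarith

/-- The slack `ε/4` does not accumulate: each new `high` has its own bound from the dichotomy. -/
lemma Segment.Brackets.loopBody {α γ : Set.Icc (0 : ℝ) 1} (hα : (α : ℝ) ≤ 1 / 2) {T : ℕ}
    (hT : 1 ≤ T) {ε : ℝ} (hε : 0 < ε) {solver : ℝ → ℝ → Policy × ℝ}
    (hsolver : IsMDPSolver α γ T solver) {m : ℝ}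
    (hm : IsGreatest (REV α γ '' truncatedPolicies T) m) {s : Segment} (hs : s.Brackets ε m) :
    (loopBody solver ε s).Brackets ε m := by
  have hd := solver_dichotomy hα hT hε hsolver hm hs.mid_mem
  have hπ := (hsolver s.mid hs.mid_mem (ε / 8) (by positivity)).1.1
  obtain ⟨h1, h2, h3, h4, h5⟩ := hs
  have e1 : s.low ≤ s.mid := by unfold Segment.mid; linarith
  have e2 : s.mid ≤ s.high := by unfold Segment.mid; linarith
  unfold SelfishMining.loopBody
  split_ifs with h
  · exact ⟨h1.trans e1, e2, h3, (hd.1 h).le.trans (hm.2 ⟨_, hπ, rfl⟩), h5⟩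
  · exact ⟨h1, e1, e2.trans h3, h4, (hd.2 h).1⟩

lemma iterate_loopBody_brackets {α γ : Set.Icc (0 : ℝ) 1} (hα : (α : ℝ) ≤ 1 / 2) {T : ℕ}
    (hT : 1 ≤ T) {ε : ℝ} (hε : 0 < ε) {solver : ℝ → ℝ → Policy × ℝ}
    (hsolver : IsMDPSolver α γ T solver) {m : ℝ}
    (hm : IsGreatest (REV α γ '' truncatedPolicies T) m) (n : ℕ) :
    ((loopBody solver ε)^[n] ⟨0, 1⟩).Brackets ε m := by
  induction n with
  | zero =>
    obtain ⟨π, hπ, rfl⟩ := hm.1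
    obtain ⟨g, -, -, h0, h1, -⟩ := exists_value_eq (γ := γ) hα hT hπ
    exact ⟨le_rfl, zero_le_one, le_rfl, h0, by simp only [Function.iterate_zero, id]; linarith⟩
  | succ n ih =>
    rw [Function.iterate_succ_apply']
    exact ih.loopBody hα hT hε hsolver hm

end SelfishMining

theorem proposition4 (α γ : Set.Icc (0 : ℝ) 1) (hα : (α : ℝ) ≤ 1 / 2) (T₀ : ℕ) (hT₀ : 1 ≤ T₀)
    (ε : ℝ) (hε : 0 < ε) :
    (∃ solver : ℝ → ℝ → SelfishMining.Policy × ℝ, SelfishMining.IsMDPSolver α γ T₀ solver) ∧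
    ∀ solver : ℝ → ℝ → SelfishMining.Policy × ℝ, SelfishMining.IsMDPSolver α γ T₀ solver →
      ∃ (ρ : ℝ) (π : SelfishMining.Policy),
        SelfishMining.HaltsWithOutput solver ε ρ π ∧
        π ∈ SelfishMining.truncatedPolicies T₀ ∧
        |ρ - SelfishMining.REV α γ π| < ε ∧
        ∃ m : ℝ, IsGreatest (SelfishMining.REV α γ '' SelfishMining.truncatedPolicies T₀) m ∧
          |ρ - m| < ε ∧ m - ε < SelfishMining.REV α γ π := by
  refine ⟨SelfishMining.exists_isMDPSolver γ hα hT₀, fun solver hsolver => ?_⟩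
  obtain ⟨m, hm⟩ := SelfishMining.exists_isGreatest_REV α γ hT₀
  have hhalt : ∃ n : ℕ, ((SelfishMining.loopBody solver ε)^[n + 1] ⟨0, 1⟩).high
      - ((SelfishMining.loopBody solver ε)^[n + 1] ⟨0, 1⟩).low < ε / 8 := by
    obtain ⟨n, hn⟩ := exists_pow_lt_of_lt_one (by positivity : (0 : ℝ) < ε / 8)
      (by norm_num : (1 / 2 : ℝ) < 1)
    refine ⟨n, ?_⟩
    rw [SelfishMining.iterate_loopBody_width]
    exact (pow_le_pow_of_le_one (by norm_num) (by norm_num) n.le_succ).trans_lt hn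
  classical
  let n := Nat.find hhalt
  let s := (SelfishMining.loopBody solver ε)^[n] ⟨0, 1⟩
  have hwidth := Nat.find_spec hhalt
  have hs : s.Brackets ε m := SelfishMining.iterate_loopBody_brackets hα hT₀ hε hsolver hm n
  -- After the last pass `ρ` is an endpoint of a segment shorter than `ε/8`.
  have hs' := hs.loopBody hα hT₀ hε hsolver hm
  have hπ := (hsolver s.mid hs.mid_mem (ε / 8) (by positivity)).1.1
  have hd := SelfishMining.solver_dichotomy hα hT₀ hε hsolver hm hs.mid_mem
  have hle : SelfishMining.REV α γ (solver s.mid (ε / 8)).1 ≤ m := hm.2 ⟨_, hπ, rfl⟩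
  refine ⟨s.mid, (solver s.mid (ε / 8)).1, ⟨n, fun k hk => not_lt.1 (Nat.find_min hhalt hk),
    hwidth, rfl, rfl⟩, hπ, ?_⟩
  rw [Function.iterate_succ_apply'] at hwidth
  change (SelfishMining.loopBody solver ε s).high - (SelfishMining.loopBody solver ε s).low
    < ε / 8 at hwidth
  obtain ⟨-, -, -, hlow, hhigh⟩ := hs'
  unfold SelfishMining.loopBody at hwidth hlow hhigh
  split_ifs at hwidth hlow hhigh with h
  -- Here `ρ = low`, so `ρ < REV π ≤ m < ρ + 3ε/8`.
  · have h1 := hd.1 h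
    simp only at hwidth hlow hhigh
    exact ⟨abs_lt.2 ⟨by linarith, by linarith⟩, m, hm, abs_lt.2 ⟨by linarith, by linarith⟩,
      by linarith⟩
  -- Here `ρ = high`, so `ρ - ε/8 < m ≤ ρ + ε/4` and `ρ - ε/2 ≤ REV π ≤ ρ`; the gap `m - REV π` is
  -- at most `3ε/4`.
  · simp only at hwidth hlow hhigh
    obtain ⟨h1, h2, h3⟩ := hd.2 h
    have h3 := h3 (by linarith)
    exact ⟨abs_lt.2 ⟨by linarith, by linarith⟩, m, hm, abs_lt.2 ⟨by linarith, by linarith⟩,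
      by linarith⟩
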